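/- Let $R$ be a commutative ring with identity. An ideal $J$ of $R$ is called dense if $\{r\in R : Jr=0\}=0$, and an ideal is called semi-regular if it contains a finitely generated dense ideal. The ring $R$ is called strong Prüfer if every finitely generated semi-regular ideal $I$ of $R$ is locally principal, i.e. the ideal $I_{\mathfrak m}$ of $R_{\mathfrak m}$ is principal for every maximal ideal $\mathfrak m$ of $R$. An $R$-module $M$ is called semi-regular flat if $\mathrm{Tor}_1^R(R/I,M)=0$ for every finitely generated semi-regular ideal $I$ of $R$. A homomorphism $f:M\to F$ of $R$-modules is called a semi-regular flat preenvelope of $M$ if $F$ is semi-regular flat and every homomorphism $f':M\to F'$ with $F'$ semi-regular flat has the form $f'=g\circ f$ for some homomorphism $g:F\to F'$; it is called a semi-regular flat envelope of $M$ if, moreover, every endomorphism $a$ of $F$ with $a\circ f=f$ is an automorphism. Theorem 4.6. The following statements are equivalent: 1. $R$ is a strong Prüfer ring; 2. every $R$-module has a surjective semi-regular flat envelope; 3. every $R$-module has a surjective semi-regular flat preenvelope. -/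

import Mathlib

open CategoryTheory

universe u

namespace SemiRegular

section Ideals

variable {R : Type u} [CommRing R]

/-- An ideal `I` is dense if `(0 : I) = {r | I r = 0}` is zero. -/
def IsDense (I : Ideal R) : Prop :=
  ∀ r : R, (∀ a ∈ I, a * r = 0) → r = 0

/-- An ideal is semi-regular if it contains a finitely generated dense ideal. -/
def IsSemiRegular (I : Ideal R) : Prop :=
  ∃ J : Ideal R, J ≤ I ∧ J.FG ∧ IsDense J

/-- An ideal is locally principal if its extension to the localization at each maximal ideal
is principal. -/
def IsLocallyPrincipal (I : Ideal R) : Prop :=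
  ∀ (m : Ideal R) [m.IsMaximal],
    (I.map (algebraMap R (Localization.AtPrime m))).IsPrincipal

end Ideals

/-- A ring is strong Prüfer if each of its finitely generated semi-regular ideals is locally
principal. -/
def IsStrongPrufer (R : Type u) [CommRing R] : Prop :=
  ∀ I : Ideal R, I.FG → IsSemiRegular I → IsLocallyPrincipal I

/-- The class of semi-regular flat modules: those `M` with `Tor₁(R ⧸ I, M) = 0` for every finitely
generated semi-regular ideal `I`. -/
def semiRegularFlat (R : Type u) [CommRing R] : ObjectProperty (ModuleCat.{u} R) :=
  fun M => ∀ I : Ideal R, I.FG → IsSemiRegular I →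
    Limits.IsZero (((Tor (ModuleCat.{u} R) 1).obj (ModuleCat.of R (R ⧸ I))).obj M)

section Envelopes

variable {R : Type u} [CommRing R]

/-- `f : M ⟶ F` is a `P`-preenvelope of `M`: `F` lies in `P`, and every morphism from `M` to an
object of `P` factors through `f`. -/
def IsPreenvelope (P : ObjectProperty (ModuleCat.{u} R)) {M F : ModuleCat.{u} R}
    (f : M ⟶ F) : Prop :=
  P F ∧ ∀ (F' : ModuleCat.{u} R), P F' → ∀ f' : M ⟶ F', ∃ g : F ⟶ F', f ≫ g = f'

/-- `f : M ⟶ F` is a `P`-envelope of `M`: it is a `P`-preenvelope, and every endomorphism `a` of `F`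
with `a ∘ f = f` is an automorphism. -/
def IsEnvelope (P : ObjectProperty (ModuleCat.{u} R)) {M F : ModuleCat.{u} R}
    (f : M ⟶ F) : Prop :=
  IsPreenvelope P f ∧ ∀ a : F ⟶ F, f ≫ a = f → IsIso a

end Envelopes

end SemiRegular

namespace SemiRegular

/-! ### Vanishing of Tor as injectivity of `I ⊗ M → R ⊗ M`. -/

section Tensor

open TensorProduct LinearMap

variable {R : Type*} [CommRing R]

/-! `Tor₁(R ⧸ I, M) = 0` says that `I ⊗ M → M` is injective (`isZero_tor_one_iff`). If `I` is
finitely generated, dense and locally principal, this holds exactly when `I` kills no nonzero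
element of `M`. So over a strong Prüfer ring semi-regular flat means torsion-free, and `M → M ⧸
denseTorsion R M` is the preenvelope. Being epi, it is an envelope. Conversely, a surjective
preenvelope of a finitely generated semi-regular ideal `I` is injective because `I → R` factors
through it. Hence `I` is itself semi-regular flat and `I ⊗ I → I` is injective. Then `a ⊗ b = b ⊗
a`, which forces `I ⧸ mI` to have dimension at most one, and Nakayama makes `I` locally principal.
-/

theorem lTensor_rTensor_comm {A B N N' : Type*} [AddCommGroup A] [AddCommGroup B] [AddCommGroup N]
    [AddCommGroup N'] [Module R A] [Module R B] [Module R N] [Module R N']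
    (f : A →ₗ[R] B) (g : N →ₗ[R] N') (t : A ⊗[R] N) :
    lTensor B g (rTensor N f t) = rTensor N' f (lTensor A g t) := by
  rw [← LinearMap.comp_apply, lTensor_comp_rTensor, ← rTensor_comp_lTensor, LinearMap.comp_apply]

/-- `Tor₁` computed through a resolution `P₂ → P₁ → P₀` of `M` vanishes on the cokernel of an
injection `i : A → B` of flat target exactly when `A ⊗ M → B ⊗ M` is injective. -/
theorem exact_lTensor_iff_injective_rTensor
    {A B C P₂ P₁ P₀ M : Type*} [AddCommGroup A] [AddCommGroup B] [AddCommGroup C]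
    [AddCommGroup P₂] [AddCommGroup P₁] [AddCommGroup P₀] [AddCommGroup M]
    [Module R A] [Module R B] [Module R C] [Module R P₂] [Module R P₁] [Module R P₀] [Module R M]
    [Module.Flat R B] [Module.Flat R P₀]
    {i : A →ₗ[R] B} {q : B →ₗ[R] C} (hi : Function.Injective i) (hiq : Function.Exact i q)
    (hq : Function.Surjective q)
    {d₂ : P₂ →ₗ[R] P₁} {d₁ : P₁ →ₗ[R] P₀} {π : P₀ →ₗ[R] M}
    (h₁ : Function.Exact d₂ d₁) (h₀ : Function.Exact d₁ π) (hπ : Function.Surjective π) :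
    Function.Exact (lTensor C d₂) (lTensor C d₁) ↔ Function.Injective (rTensor M i) := by
  have hB₁ := Module.Flat.lTensor_exact B h₁
  have hB₀ := Module.Flat.lTensor_exact B h₀
  have hA₀ := _root_.lTensor_exact A h₀ hπ
  constructor
  · intro h
    rw [injective_iff_map_eq_zero]
    intro t ht
    obtain ⟨u, rfl⟩ := lTensor_surjective A hπ t
    rw [← lTensor_rTensor_comm] at ht
    obtain ⟨p, hp⟩ := (hB₀ _).1 ht
    have hp0 : lTensor C d₁ (rTensor P₁ q p) = 0 := by
      rw [lTensor_rTensor_comm, hp]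
      exact (rTensor_exact P₀ hiq hq).apply_apply_eq_zero u
    obtain ⟨p₂', hp₂⟩ := (h _).1 hp0
    obtain ⟨p₂, rfl⟩ := rTensor_surjective P₂ hq p₂'
    -- Corrected by a boundary, `p` dies in `C ⊗ P₁` and so comes from `A ⊗ P₁`.
    have : rTensor P₁ q (p - lTensor B d₂ p₂) = 0 := by
      rw [map_sub, ← lTensor_rTensor_comm, hp₂, sub_self]
    obtain ⟨v, hv⟩ := (rTensor_exact P₁ hiq hq _).1 this
    have huv : lTensor A d₁ v = u := by
      apply Module.Flat.rTensor_preserves_injective_linearMap (M := P₀) i hi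
      rw [← lTensor_rTensor_comm, hv, map_sub, hB₁.apply_apply_eq_zero, sub_zero, hp]
    rw [← huv, hA₀.apply_apply_eq_zero]
  · intro h t
    constructor
    · intro ht
      obtain ⟨p, rfl⟩ := rTensor_surjective P₁ hq t
      rw [lTensor_rTensor_comm] at ht
      obtain ⟨w, hw⟩ := (rTensor_exact P₀ hiq hq _).1 ht
      have hw0 : lTensor A π w = 0 := by
        apply h
        rw [← lTensor_rTensor_comm, hw, hB₀.apply_apply_eq_zero, map_zero]
      obtain ⟨v, rfl⟩ := (hA₀ _).1 hw0
      have : lTensor B d₁ (p - rTensor P₁ i v) = 0 := by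
        rw [map_sub, lTensor_rTensor_comm, hw, sub_self]
      obtain ⟨p₂, hp₂⟩ := (hB₁ _).1 this
      refine ⟨rTensor P₂ q p₂, ?_⟩
      rw [lTensor_rTensor_comm, hp₂, map_sub, (rTensor_exact P₁ hiq hq).apply_apply_eq_zero, sub_zero]
    · rintro ⟨s, rfl⟩
      rw [← LinearMap.comp_apply, ← lTensor_comp, h₁.linearMap_comp_eq_zero, lTensor_zero, LinearMap.zero_apply]

end Tensor

theorem isZero_tor_one_iff {R : Type u} [CommRing R] (I : Ideal R) (M : ModuleCat.{u} R) :
    Limits.IsZero (((Tor (ModuleCat.{u} R) 1).obj (ModuleCat.of R (R ⧸ I))).obj M) ↔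
      Function.Injective (LinearMap.rTensor M I.subtype) := by
  let P := projectiveResolution M
  let F := (MonoidalCategory.tensoringLeft (ModuleCat.{u} R)).obj (ModuleCat.of R (R ⧸ I))
  have hflat : Module.Flat R (P.complex.X 0) :=
    have : Module.Projective R (P.complex.X 0) :=
      (IsProjective.iff_projective (R := R) (P.complex.X 0)).2 (P.projective 0)
    inferInstance
  have h₁ := (ShortComplex.ShortExact.moduleCat_exact_iff_function_exact _).1 (P.exact_succ 0)
  have h₀ := (ShortComplex.ShortExact.moduleCat_exact_iff_function_exact _).1 P.exact₀
  have hπ : Function.Surjective (P.π.f 0).hom := (ModuleCat.epi_iff_surjective _).1 inferInstance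
  rw [← exact_lTensor_iff_injective_rTensor (C := R ⧸ I) (M := M)
    (π := (show P.complex.X 0 ⟶ M from P.π.f 0).hom) I.injective_subtype
    (LinearMap.exact_subtype_mkQ I) I.mkQ_surjective h₁ h₀ hπ]
  refine (P.isoLeftDerivedObj F 1).isZero_iff.trans ?_
  refine ((F.mapHomologicalComplex _).obj P.complex |>.exactAt_iff_isZero_homology 1).symm.trans ?_
  rw [HomologicalComplex.exactAt_iff' _ 2 1 0 (by simp) (by simp),
    ShortComplex.ShortExact.moduleCat_exact_iff_function_exact]
  rfl


/-! ### Dense ideals, and local principality without denominators. -/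

section Ideals

variable {R : Type u} [CommRing R]

theorem IsDense.mono {I J : Ideal R} (hI : IsDense I) (h : I ≤ J) : IsDense J :=
  fun r hr => hI r fun a ha => hr a (h ha)

theorem IsSemiRegular.isDense {I : Ideal R} (hI : IsSemiRegular I) : IsDense I :=
  let ⟨_, hJI, _, hJ⟩ := hI
  hJ.mono hJI

theorem IsDense.isSemiRegular {I : Ideal R} (hI : IsDense I) (hfg : I.FG) : IsSemiRegular I :=
  ⟨I, le_rfl, hfg, hI⟩

theorem isDense_top : IsDense (⊤ : Ideal R) := fun r hr => by
  simpa using hr 1 trivial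

theorem IsDense.mul {I J : Ideal R} (hI : IsDense I) (hJ : IsDense J) : IsDense (I * J) :=
  fun r hr => hJ r fun b hb => hI _ fun a ha => by
    rw [← mul_assoc]
    exact hr _ (Ideal.mul_mem_mul ha hb)

/-- A generator of the localized ideal is, up to a unit, the image of some `a ∈ I`; the product of
the denominators of finitely many generators of `I` serves as `s`. -/
theorem IsLocallyPrincipal.exists_mul_mem_span {I : Ideal R} (hI : IsLocallyPrincipal I)
    (hfg : I.FG) (m : Ideal R) [m.IsMaximal] :
    ∃ s ∉ m, ∃ a ∈ I, ∀ i ∈ I, s * i ∈ Ideal.span {a} := by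
  obtain ⟨g, hg⟩ := hI m
  have hgI : g ∈ I.map (algebraMap R (Localization.AtPrime m)) := by
    rw [hg]
    exact Submodule.mem_span_singleton_self g
  obtain ⟨⟨⟨a, ha⟩, t⟩, hat⟩ := (IsLocalization.mem_map_algebraMap_iff m.primeCompl _).1 hgI
  have key : ∀ i ∈ I, ∃ s ∉ m, s * i ∈ Ideal.span {a} := by
    intro i hi
    have hi' : algebraMap R (Localization.AtPrime m) i ∈
        (Ideal.span {a}).map (algebraMap R (Localization.AtPrime m)) := by
      have h₁ := Ideal.mem_map_of_mem (algebraMap R (Localization.AtPrime m)) hi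
      rw [hg, Submodule.mem_span_singleton] at h₁
      obtain ⟨c, hc⟩ := h₁
      obtain ⟨u, hu⟩ := (IsLocalization.map_units (Localization.AtPrime m) t).exists_right_inv
      have : algebraMap R (Localization.AtPrime m) i =
          c * u * algebraMap R (Localization.AtPrime m) a := by
        rw [← hc, smul_eq_mul, ← hat]
        linear_combination (-(c * g)) * hu
      rw [this]
      exact Ideal.mul_mem_left _ _ (Ideal.mem_map_of_mem _ (Ideal.mem_span_singleton_self a))
    obtain ⟨s, hs, h⟩ := (IsLocalization.algebraMap_mem_map_algebraMap_iff m.primeCompl _ _ _).1 hi'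
    exact ⟨s, hs, h⟩
  obtain ⟨S, hS⟩ := hfg
  choose! s hsm hs using key
  have hSI : ∀ i ∈ S, i ∈ I := fun i hi => hS ▸ Ideal.subset_span hi
  refine ⟨∏ i ∈ S, s i, fun h => ?_, a, ha, ?_⟩
  · obtain ⟨i, hi, hi'⟩ := (Ideal.IsPrime.prod_mem_iff (p := m)).1 h
    exact hsm i (hSI i hi) hi'
  · intro i hi
    have : I ≤ Submodule.comap (LinearMap.mulLeft R (∏ i ∈ S, s i)) (Ideal.span {a}) := by
      rw [← hS]
      refine Submodule.span_le.2 fun j hj => ?_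
      obtain ⟨c, hc⟩ := Finset.dvd_prod_of_mem s hj
      change (∏ i ∈ S, s i) * j ∈ Ideal.span {a}
      rw [hc, mul_right_comm]
      exact Ideal.mul_mem_right _ _ (hs j (hSI j hj))
    exact this hi

theorem isLocallyPrincipal_of_exists_mul_mem_span {I : Ideal R}
    (h : ∀ (m : Ideal R) [m.IsMaximal], ∃ s ∉ m, ∃ a ∈ I, ∀ i ∈ I, s * i ∈ Ideal.span {a}) :
    IsLocallyPrincipal I := by
  intro m _
  obtain ⟨s, hs, a, ha, H⟩ := h m
  refine ⟨algebraMap R _ a, le_antisymm ?_ ?_⟩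
  · refine Ideal.map_le_iff_le_comap.2 fun i hi => ?_
    obtain ⟨c, hc⟩ := Ideal.mem_span_singleton'.1 (H i hi)
    have hu := IsLocalization.map_units (Localization.AtPrime m) (⟨s, hs⟩ : m.primeCompl)
    have : algebraMap R (Localization.AtPrime m) s * algebraMap R _ i ∈
        Ideal.span {algebraMap R (Localization.AtPrime m) a} := by
      rw [← map_mul, ← hc, map_mul]
      exact Ideal.mul_mem_left _ _ (Ideal.mem_span_singleton_self _)
    exact (Ideal.unit_mul_mem_iff_mem _ hu).1 this
  · exact (Ideal.span_singleton_le_iff_mem _).2 (Ideal.mem_map_of_mem _ ha)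

end Ideals

/-! ### Torsion-freeness versus injectivity of `I ⊗ M → M`. -/

section Flatness

open TensorProduct

variable {R : Type u} [CommRing R] {M : Type*} [AddCommGroup M] [Module R M]

theorem eq_zero_of_forall_maximal {x : M}
    (h : ∀ (m : Ideal R) [m.IsMaximal], ∃ s ∉ m, s • x = 0) : x = 0 := by
  by_contra hx
  have : Ideal.torsionOf R M x ≠ ⊤ := by
    rwa [Ne, Ideal.torsionOf_eq_top_iff]
  obtain ⟨m, hm, hle⟩ := Ideal.exists_le_maximal _ this
  obtain ⟨s, hs, hsx⟩ := h m
  exact hs (hle hsx)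

theorem injective_rTensor_of_torsionFree {I : Ideal R} (hfg : I.FG) (hI : IsLocallyPrincipal I)
    (hM : ∀ x : M, (∀ i ∈ I, i • x = 0) → x = 0) :
    Function.Injective (LinearMap.rTensor M I.subtype) := by
  rw [injective_iff_map_eq_zero]
  intro t ht
  refine eq_zero_of_forall_maximal (R := R) fun m _ => ?_
  obtain ⟨s, hs, a, ha, H⟩ := hI.exists_mul_mem_span hfg m
  -- Multiplication by `s` turns every tensor into a pure one with left factor `a`; a second `s`
  -- will kill the right factor.
  have hy : ∀ t : I ⊗[R] M, ∃ y : M, s • t = (⟨a, ha⟩ : I) ⊗ₜ[R] y := by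
    intro t
    induction t with
    | zero => exact ⟨0, by simp⟩
    | tmul i x =>
      obtain ⟨c, hc⟩ := Ideal.mem_span_singleton'.1 (H i i.2)
      refine ⟨c • x, ?_⟩
      rw [TensorProduct.smul_tmul', ← TensorProduct.smul_tmul]
      congr 1
      exact Subtype.ext hc.symm
    | add t₁ t₂ h₁ h₂ =>
      obtain ⟨y₁, h₁⟩ := h₁
      obtain ⟨y₂, h₂⟩ := h₂
      exact ⟨y₁ + y₂, by rw [smul_add, h₁, h₂, TensorProduct.tmul_add]⟩
  obtain ⟨y, hy⟩ := hy t
  have hay : a • y = 0 := by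
    have := congrArg (fun t => TensorProduct.lid R M (LinearMap.rTensor M I.subtype t)) hy
    simpa [ht] using this.symm
  have hsy : s • y = 0 := hM _ fun i hi => by
    obtain ⟨c, hc⟩ := Ideal.mem_span_singleton'.1 (H i hi)
    rw [smul_smul, mul_comm, ← hc, mul_smul, hay, smul_zero]
  refine ⟨s * s, fun h => hs ((Ideal.IsPrime.mem_or_mem inferInstance h).elim id id), ?_⟩
  rw [mul_smul, hy, ← TensorProduct.tmul_smul, hsy, TensorProduct.tmul_zero]

/-- Write `s * i = c i * a`. The coefficient `c i` is unique only modulo the annihilator of `a`, but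
density of `I` makes `s` kill that annihilator. Hence `s * c` is a linear map `I → R` sending `a` to
`s * s`, and applying it to `a ⊗ x = 0` gives `s * s • x = 0`. -/
theorem torsionFree_of_injective_rTensor {I : Ideal R} (hfg : I.FG) (hI : IsLocallyPrincipal I)
    (hd : IsDense I) (hinj : Function.Injective (LinearMap.rTensor M I.subtype))
    {x : M} (hx : ∀ i ∈ I, i • x = 0) : x = 0 := by
  refine eq_zero_of_forall_maximal (R := R) fun m _ => ?_
  obtain ⟨s, hs, a, ha, H⟩ := hI.exists_mul_mem_span hfg m
  have hann : ∀ r, r * a = 0 → s * r = 0 := fun r hr => hd _ fun i hi => by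
    obtain ⟨c, hc⟩ := Ideal.mem_span_singleton'.1 (H i hi)
    linear_combination r * -hc + c * hr
  have H' : ∀ i : I, ∃ c, c * a = s * i := fun i => Ideal.mem_span_singleton'.1 (H i i.2)
  choose c hc using H'
  let f : I →ₗ[R] R :=
    { toFun := fun i => s * c i
      map_add' := fun i j => by
        have := hann (c (i + j) - c i - c j) (by
          have := hc (i + j)
          push_cast at this
          linear_combination this - hc i - hc j)
        linear_combination this
      map_smul' := fun r i => by
        have := hann (c (r • i) - r * c i) (by
          have := hc (r • i)
          push_cast [smul_eq_mul] at this
          linear_combination this - r * hc i)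
        simp only [RingHom.id_apply, smul_eq_mul]
        linear_combination this }
  have hax : (⟨a, ha⟩ : I) ⊗ₜ[R] x = 0 := hinj (by
    apply (TensorProduct.lid R M).injective
    rw [map_zero, LinearMap.rTensor_tmul, Submodule.subtype_apply, TensorProduct.lid_tmul, hx a ha,
      map_zero])
  have h₁ : f ⟨a, ha⟩ • x = 0 := by
    have := congrArg (fun t => TensorProduct.lid R M (LinearMap.rTensor M f t)) hax
    simpa using this
  have h₂ : f ⟨a, ha⟩ = s * s := by
    have := hann (c ⟨a, ha⟩ - s) (by linear_combination hc ⟨a, ha⟩)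
    change s * c ⟨a, ha⟩ = s * s
    linear_combination this
  refine ⟨s * s, fun h => hs ((Ideal.IsPrime.mem_or_mem inferInstance h).elim id id), ?_⟩
  rw [← h₂, h₁]

theorem isLocallyPrincipal_of_tmul_comm {I : Ideal R} (hfg : I.FG)
    (h : ∀ a b : I, a ⊗ₜ[R] b = b ⊗ₜ[R] a) : IsLocallyPrincipal I := by
  refine isLocallyPrincipal_of_exists_mul_mem_span fun m _ => ?_
  let := Ideal.Quotient.field m
  let V := I ⧸ (m • ⊤ : Submodule R I)
  let π : I →ₗ[R] V := Submodule.mkQ _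
  have hcyc : ∃ a : I, ∀ b : I, ∃ r : R, π b = r • π a := by
    by_cases hV : ∀ a, π a = 0
    · exact ⟨0, fun b => ⟨0, by simp [hV]⟩⟩
    · push Not at hV
      obtain ⟨a, ha⟩ := hV
      obtain ⟨φ, hφ⟩ : ∃ φ : Module.Dual (R ⧸ m) V, φ (π a) ≠ 0 := by
        by_contra! H
        exact ha ((Module.forall_dual_apply_eq_zero_iff (R ⧸ m) _).1 H)
      let ψ : I →ₗ[R] (R ⧸ m) := φ.restrictScalars R ∘ₗ π
      -- Evaluating this bilinear map on the symmetry of tensors gives `ψ a • π b = ψ b • π a`, so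
      -- `π a` spans `V`.
      let B : I →ₗ[R] I →ₗ[R] V := LinearMap.mk₂ R (fun a b => ψ a • π b)
        (fun a₁ a₂ b => by rw [map_add, add_smul])
        (fun r a b => by rw [map_smul, smul_assoc])
        (fun a b₁ b₂ => by rw [map_add, smul_add])
        (fun r a b => by rw [map_smul, smul_comm])
      refine ⟨a, fun b => ?_⟩
      have hab : ψ a • π b = ψ b • π a := congrArg (TensorProduct.lift B) (h a b)
      obtain ⟨r, hr⟩ := Ideal.Quotient.mk_surjective ((ψ a)⁻¹ * ψ b)
      refine ⟨r, ?_⟩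
      calc π b = (ψ a)⁻¹ • ψ a • π b := (inv_smul_smul₀ (show ψ a ≠ 0 from hφ) _).symm
        _ = ((ψ a)⁻¹ * ψ b) • π a := by rw [hab, mul_smul]
        _ = r • π a := by rw [← hr]; rfl
  obtain ⟨a, ha⟩ := hcyc
  have hle : I ≤ Ideal.span {(a : R)} ⊔ m • I := by
    intro i hi
    obtain ⟨r, hr⟩ := ha ⟨i, hi⟩
    rw [← map_smul, ← sub_eq_zero, ← map_sub] at hr
    have hmem := Submodule.mem_map_of_mem (f := I.subtype) ((Submodule.Quotient.mk_eq_zero _).1 hr)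
    rw [Submodule.map_smul'', Submodule.map_subtype_top] at hmem
    refine Submodule.mem_sup.2 ⟨r * a, Ideal.mem_span_singleton'.2 ⟨r, rfl⟩, _, hmem, ?_⟩
    simp
  -- Nakayama, in the form giving `s ∈ 1 + m` with `s I ⊆ (a)`.
  obtain ⟨s, hs, hsI⟩ := Submodule.exists_sub_one_mem_and_smul_le_of_fg_of_le_sup hfg le_rfl hle
  refine ⟨s, fun hsm => ?_, a, a.2, fun i hi => hsI (Submodule.smul_mem_pointwise_smul i s I hi)⟩
  exact (Ideal.ne_top_iff_one m).1 (Ideal.IsMaximal.ne_top inferInstance)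
    (by simpa using m.sub_mem hsm hs)

variable (R M) in
/-- The submodule of elements annihilated by a finitely generated dense ideal. -/
def denseTorsion : Submodule R M where
  carrier := {x | ∃ I : Ideal R, I.FG ∧ IsDense I ∧ ∀ i ∈ I, i • x = 0}
  zero_mem' := ⟨⊤, Ideal.fg_top R, isDense_top, fun i _ => smul_zero i⟩
  add_mem' := by
    rintro x y ⟨I, hI, hI', hx⟩ ⟨J, hJ, hJ', hy⟩
    refine ⟨I * J, Ideal.FG.mul hI hJ, hI'.mul hJ', fun i hi => ?_⟩
    have hiI : i ∈ I := Ideal.mul_le_left hi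
    have hiJ : i ∈ J := Ideal.mul_le_right hi
    rw [smul_add, hx i hiI, hy i hiJ, add_zero]
  smul_mem' := by
    rintro r x ⟨I, hI, hI', hx⟩
    exact ⟨I, hI, hI', fun i hi => by rw [smul_comm, hx i hi, smul_zero]⟩

/-- This makes the quotient by the dense torsion torsion-free: `x` is killed by `I` times the
product of the dense ideals attached to the generators of `I`. -/
theorem mem_denseTorsion_of_forall_smul_mem {I : Ideal R} (hfg : I.FG) (hd : IsDense I) {x : M}
    (hx : ∀ i ∈ I, i • x ∈ denseTorsion R M) : x ∈ denseTorsion R M := by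
  obtain ⟨S, hS⟩ := hfg
  choose! J hJ hJ' hJx using hx
  have hSI : ∀ i ∈ S, i ∈ I := fun i hi => hS ▸ Ideal.subset_span hi
  have hP : (∏ i ∈ S, J i).FG ∧ IsDense (∏ i ∈ S, J i) :=
    Finset.prod_induction J (fun K => K.FG ∧ IsDense K)
      (fun _ _ hA hB => ⟨Ideal.FG.mul hA.1 hB.1, hA.2.mul hB.2⟩)
      ⟨by rw [Ideal.one_eq_top]; exact Ideal.fg_top R, by
        rw [Ideal.one_eq_top]; exact isDense_top⟩
      fun i hi => ⟨hJ i (hSI i hi), hJ' i (hSI i hi)⟩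
  refine ⟨(∏ i ∈ S, J i) * I, Ideal.FG.mul hP.1 ⟨S, hS⟩, hP.2.mul hd, fun k hk => ?_⟩
  have hle : (∏ i ∈ S, J i) * I ≤ Ideal.torsionOf R M x := by
    conv_lhs => rw [← hS]
    refine Ideal.mul_le.2 fun j hj i hi => ?_
    have : Ideal.span (S : Set R) ≤ Submodule.comap (LinearMap.mulLeft R j) (Ideal.torsionOf R M x) := by
      refine Submodule.span_le.2 fun i hi => ?_
      change (j * i) • x = 0
      rw [mul_smul]
      exact hJx i (hSI i hi) j (Finset.inf_le (f := J) hi (Ideal.prod_le_inf hj))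
    exact this hi
  exact hle hk

end Flatness

/-! ### Preenvelopes and the equivalence. -/

theorem semiRegularFlat_iff {R : Type u} [CommRing R] (M : ModuleCat.{u} R) :
    semiRegularFlat R M ↔ ∀ I : Ideal R, I.FG → IsDense I →
      Function.Injective (LinearMap.rTensor M I.subtype) :=
  forall₂_congr fun I hfg => by
    rw [isZero_tor_one_iff]
    exact ⟨fun h hd => h (hd.isSemiRegular hfg), fun h hd => h hd.isDense⟩

/-- Over a strong Prüfer ring, the quotient of a module by its dense torsion is a semi-regular flat
preenvelope. -/
theorem IsStrongPrufer.isPreenvelope_mkQ {R : Type u} [CommRing R] (hR : IsStrongPrufer R)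
    (M : ModuleCat.{u} R) :
    IsPreenvelope (semiRegularFlat R) (ModuleCat.ofHom (denseTorsion R M).mkQ) := by
  refine ⟨?_, fun F hF f => ?_⟩
  · rw [semiRegularFlat_iff]
    intro I hfg hd
    refine injective_rTensor_of_torsionFree hfg (hR I hfg (hd.isSemiRegular hfg)) fun x hx => ?_
    obtain ⟨x, rfl⟩ := Submodule.mkQ_surjective _ x
    rw [Submodule.mkQ_apply, Submodule.Quotient.mk_eq_zero]
    refine mem_denseTorsion_of_forall_smul_mem hfg hd fun i hi => ?_
    rw [← Submodule.Quotient.mk_eq_zero]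
    exact hx i hi
  · rw [semiRegularFlat_iff] at hF
    refine ⟨ModuleCat.ofHom ((denseTorsion R M).liftQ f.hom ?_), ?_⟩
    · rintro x ⟨I, hfg, hd, hx⟩
      exact torsionFree_of_injective_rTensor hfg (hR I hfg (hd.isSemiRegular hfg)) hd
        (hF I hfg hd) fun i hi => by rw [← map_smul, hx i hi, map_zero]
    · ext x
      rfl

theorem IsPreenvelope.isEnvelope_of_surjective {R : Type u} [CommRing R]
    {P : ObjectProperty (ModuleCat.{u} R)} {M F : ModuleCat.{u} R} {f : M ⟶ F}
    (hf : IsPreenvelope P f) (hs : Function.Surjective f) : IsEnvelope P f := by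
  refine ⟨hf, fun a ha => ?_⟩
  have : Epi f := (ModuleCat.epi_iff_surjective f).2 hs
  obtain rfl : a = 𝟙 F := (cancel_epi f).1 (by rw [ha, Category.comp_id])
  infer_instance

theorem isStrongPrufer_of_surjective_preenvelope {R : Type u} [CommRing R]
    (h : ∀ M : ModuleCat.{u} R, ∃ (F : ModuleCat.{u} R) (f : M ⟶ F),
      IsPreenvelope (semiRegularFlat R) f ∧ Function.Surjective f) : IsStrongPrufer R := by
  intro I hfg hI
  obtain ⟨F, f, ⟨hF, hf⟩, hs⟩ := h (ModuleCat.of R I)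
  have hRflat : semiRegularFlat R (ModuleCat.of R R) := (semiRegularFlat_iff _).2 fun J _ _ =>
    Module.Flat.rTensor_preserves_injective_linearMap (M := R) J.subtype J.injective_subtype
  obtain ⟨g, hg⟩ := hf _ hRflat (ModuleCat.ofHom I.subtype)
  -- `f` is injective because the inclusion of `I` in the flat module `R` factors through it.
  have hfi : Function.Injective f.hom := fun x y hxy => by
    have := congrArg g.hom hxy
    rw [← LinearMap.comp_apply, ← LinearMap.comp_apply, ← ModuleCat.hom_comp, hg] at this
    exact Subtype.ext this
  let e : I ≃ₗ[R] F := LinearEquiv.ofBijective f.hom ⟨hfi, hs⟩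
  have hinj : Function.Injective (LinearMap.rTensor I I.subtype) := by
    rw [injective_iff_map_eq_zero]
    intro t ht
    apply (e.lTensor I).injective
    apply (semiRegularFlat_iff F).1 hF I hfg hI.isDense
    rw [map_zero, map_zero]
    refine (lTensor_rTensor_comm I.subtype e.toLinearMap t).symm.trans ?_
    rw [ht, map_zero]
  -- Both `a ⊗ b` and `b ⊗ a` map to the product `a * b`.
  refine isLocallyPrincipal_of_tmul_comm hfg fun a b => hinj ?_
  apply (TensorProduct.lid R I).injective
  exact Subtype.ext (mul_comm (a : R) b)

end SemiRegular

theorem theorem4p6 (R : Type u) [CommRing R] :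
    [SemiRegular.IsStrongPrufer R,
      ∀ M : ModuleCat.{u} R, ∃ (F : ModuleCat.{u} R) (f : M ⟶ F),
        SemiRegular.IsEnvelope (SemiRegular.semiRegularFlat R) f ∧ Function.Surjective f,
      ∀ M : ModuleCat.{u} R, ∃ (F : ModuleCat.{u} R) (f : M ⟶ F),
        SemiRegular.IsPreenvelope (SemiRegular.semiRegularFlat R) f ∧
          Function.Surjective f].TFAE := by
  tfae_have 1 → 2 := fun hR M =>
    have hs : Function.Surjective (SemiRegular.denseTorsion R M).mkQ := Submodule.mkQ_surjective _
    ⟨_, _, (hR.isPreenvelope_mkQ M).isEnvelope_of_surjective hs, hs⟩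
  tfae_have 2 → 3 := fun h M =>
    let ⟨F, f, hf, hs⟩ := h M
    ⟨F, f, hf.1, hs⟩
  tfae_have 3 → 1 := SemiRegular.isStrongPrufer_of_surjective_preenvelope
  tfae_finish
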